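/- All graphs are simple. For graphs $X$ and $Y$ with the same finite number of vertices, let $\mathsf{FS}(X,Y)$ be the graph whose vertices are the bijections $\sigma\colon V(X)\to V(Y)$, where $\sigma$ and $\sigma'$ are adjacent if and only if there is an edge $\{a,b\}$ of $X$ such that $\{\sigma(a),\sigma(b)\}$ is an edge of $Y$, $\sigma(a)=\sigma'(b)$, $\sigma(b)=\sigma'(a)$, and $\sigma(c)=\sigma'(c)$ for all $c\in V(X)\setminus\{a,b\}$. Let $\mathsf{Cycle}_n$ be the cycle graph on $n$ vertices. Let $Y$ be a graph with $n\ge 3$ vertices whose complement $\overline{Y}$ is a forest with connected components (trees) $\mathscr{T}_1,\ldots,\mathscr{T}_r$, and let $\nu=\gcd(|V(\mathscr{T}_1)|,\ldots,|V(\mathscr{T}_r)|)$. Then $\mathsf{FS}(\mathsf{Cycle}_n,Y)$ has exactly $\nu$ connected components. These connected components are pairwise isomorphic, and each of them contains exactly $n!/\nu$ vertices. Moreover, each connected component of $\mathsf{FS}(\mathsf{Cycle}_n,Y)$ has an automorphism of order $2$. -/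

import Mathlib

open scoped Nat

/-- The friends-and-strangers graph `FS(X, Y)`: its vertices are the bijections `V(X) → V(Y)`, and
`σ`, `τ` are adjacent iff they differ by exchanging the values at the two ends of an edge `{a, b}`
of `X` for which `{σ a, σ b}` is an edge of `Y`. -/
def FS {V W : Type*} (X : SimpleGraph V) (Y : SimpleGraph W) : SimpleGraph (V ≃ W) where
  Adj σ τ := ∃ a b : V, X.Adj a b ∧ Y.Adj (σ a) (σ b) ∧
    σ a = τ b ∧ σ b = τ a ∧ ∀ c : V, c ≠ a → c ≠ b → σ c = τ c
  symm := ⟨by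
    rintro σ τ ⟨a, b, hX, hY, h1, h2, h3⟩
    refine ⟨a, b, hX, ?_, h2.symm, h1.symm, fun c hca hcb => (h3 c hca hcb).symm⟩
    rw [← h1, ← h2]
    exact hY.symm⟩
  loopless := ⟨by
    rintro σ ⟨a, b, hX, -, h1, -⟩
    exact hX.ne (σ.injective h1)⟩

/-- The greatest common divisor of the numbers of vertices of the connected components of a
finite graph. -/
noncomputable def componentSizeGcd {V : Type*} [Finite V] (G : SimpleGraph V) : ℕ :=
  letI : Fintype G.ConnectedComponent := Fintype.ofFinite G.ConnectedComponent
  (Finset.univ : Finset G.ConnectedComponent).gcd fun C => C.supp.ncard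

/-! An arrangement is read as a word around the cycle, and rotations and reflections act on `FS` by
precomposition. In a forest some letter `v` has at most one neighbour, so in `Y` it can pass every
letter but one; removing it and inducting shows that any two arrangements are connected up to a
rotation (`FS.exists_reachable_rotation`). If the letters of one tree form a block, the block can
pass all other letters, which rotates the word by the size of the tree; hence rotation by `ν` stays
within a component (`FS.reachable_rotation_of_dvd`). Conversely, since `ν` divides all tree sizes,
the edges of `Yᶜ` carry a flow in `ZMod ν` with net inflow one at every vertex. The weight of the
ordered pairs under this flow, `orderedWeight`, is invariant along edges of `FS` and grows by one
under a unit rotation. So components are the fibres of the weight, and rotations permute them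
transitively. A reflection followed by a suitable rotation preserves a given component and is an
involution. -/

open Relation SimpleGraph

/-! ### Leaves of finite forests. -/

namespace SimpleGraph

/-- A nonempty finite forest has a vertex with at most one neighbour. -/
theorem IsAcyclic.exists_adj_imp_eq {V : Type*} [Finite V] [Nonempty V] {G : SimpleGraph V}
    (hG : G.IsAcyclic) : ∃ v w : V, ∀ u, G.Adj v u → u = w := by
  classical
  obtain ⟨x⟩ := ‹Nonempty V›
  set C := G.connectedComponentMk x
  have hT := hG.isTree_connectedComponent C
  -- Neighbours in `G` stay in `C`, so a leaf of the tree `C` is a leaf of `G`.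
  have hadj : ∀ (v : C) (u : V), G.Adj v u → ∃ h : u ∈ C, C.toSimpleGraph.Adj v ⟨u, h⟩ := by
    rintro ⟨v, hv⟩ u h
    have hu : u ∈ C := ConnectedComponent.mem_supp_of_adj_mem_supp C hv h
    exact ⟨hu, (C.toSimpleGraph_adj hv hu).2 h⟩
  have : Fintype C := Fintype.ofFinite _
  rcases subsingleton_or_nontrivial C with hs | hs
  · refine ⟨x, x, fun u hu => ?_⟩
    obtain ⟨h, -⟩ := hadj ⟨x, rfl⟩ u hu
    exact congrArg Subtype.val (Subsingleton.elim (⟨u, h⟩ : C) ⟨x, rfl⟩)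
  · obtain ⟨v, hv⟩ := hT.exists_vert_degree_one_of_nontrivial
    obtain ⟨w, -, hw⟩ := degree_eq_one_iff_existsUnique_adj.1 hv
    refine ⟨v, w, fun u hu => ?_⟩
    obtain ⟨h, h'⟩ := hadj v u hu
    exact congrArg Subtype.val (hw _ h')

theorem IsAcyclic.exists_mem_adj_imp_eq {V : Type*} {G : SimpleGraph V} (hG : G.IsAcyclic)
    (l : List V) (hl : l ≠ []) : ∃ v ∈ l, ∃ w, ∀ u ∈ l, G.Adj v u → u = w := by
  have : Finite {v | v ∈ l} := l.finite_toSet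
  obtain ⟨x, hx⟩ := List.exists_mem_of_ne_nil l hl
  have : Nonempty {v | v ∈ l} := ⟨⟨x, hx⟩⟩
  obtain ⟨v, w, h⟩ := (hG.induce {v | v ∈ l}).exists_adj_imp_eq
  exact ⟨v, v.2, w, fun u hu huv => congrArg Subtype.val (h ⟨u, hu⟩ huv)⟩

end SimpleGraph

/-! ### Words modulo swaps and rotations. -/

section Words

variable {V : Type*} (Y : SimpleGraph V)

/-- Exchange of two consecutive letters of a word that are adjacent in `Y`. -/
inductive SwapStep : List V → List V → Prop
  | intro (p q : List V) {a b : V} (h : Y.Adj a b) : SwapStep (p ++ a :: b :: q) (p ++ b :: a :: q)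

/-- Exchange of two consecutive letters adjacent in `Y`, or a cyclic rotation of the word. -/
inductive CyclicStep : List V → List V → Prop
  | swap {l l' : List V} (h : SwapStep Y l l') : CyclicStep l l'
  | rotate (p q : List V) : CyclicStep (p ++ q) (q ++ p)

variable {Y}

theorem SwapStep.symm {l l' : List V} (h : SwapStep Y l l') : SwapStep Y l' l := by
  obtain ⟨p, q, h⟩ := h
  exact ⟨p, q, h.symm⟩

theorem SwapStep.append {l l' : List V} (h : SwapStep Y l l') (r s : List V) :
    SwapStep Y (r ++ l ++ s) (r ++ l' ++ s) := by
  obtain ⟨p, q, h⟩ := h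
  simpa using SwapStep.intro (r ++ p) (q ++ s) h

theorem SwapStep.perm {l l' : List V} (h : SwapStep Y l l') : l.Perm l' := by
  obtain ⟨p, q, h⟩ := h
  exact (List.Perm.swap _ _ _).append_left p

theorem CyclicStep.perm {l l' : List V} (h : CyclicStep Y l l') : l.Perm l' := by
  cases h with
  | swap h => exact h.perm
  | rotate p q => exact List.perm_append_comm

theorem CyclicStep.symm {l l' : List V} (h : CyclicStep Y l l') : CyclicStep Y l' l := by
  cases h with
  | swap h => exact .swap h.symm
  | rotate p q => exact .rotate q p

theorem SwapStep.reflTransGen_append {l l' : List V} (h : ReflTransGen (SwapStep Y) l l')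
    (r s : List V) : ReflTransGen (SwapStep Y) (r ++ l ++ s) (r ++ l' ++ s) :=
  h.lift (fun l => r ++ l ++ s) fun _ _ h => h.append r s

theorem SwapStep.cons_append {v : V} {p : List V} (h : ∀ a ∈ p, Y.Adj v a) :
    ReflTransGen (SwapStep Y) (v :: p) (p ++ [v]) := by
  induction p with
  | nil => exact .refl
  | cons a p ih =>
    refine .head (SwapStep.intro [] p (h a (by simp))) ?_
    simpa using SwapStep.reflTransGen_append (ih fun b hb => h b (by simp [hb])) [a] []

theorem SwapStep.append_comm {p q : List V} (h : ∀ a ∈ p, ∀ b ∈ q, Y.Adj a b) :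
    ReflTransGen (SwapStep Y) (p ++ q) (q ++ p) := by
  induction p with
  | nil => simpa using .refl
  | cons a p ih =>
    have h₁ := SwapStep.reflTransGen_append
      (ih fun a ha b hb => h a (by simp [ha]) b hb) [a] []
    have h₂ := SwapStep.reflTransGen_append (SwapStep.cons_append (h a (by simp))) [] p
    simp only [List.nil_append, List.append_nil, List.append_assoc,
      List.cons_append] at h₁ h₂ ⊢
    exact h₁.trans h₂

theorem CyclicStep.of_swaps {l l' : List V} (h : ReflTransGen (SwapStep Y) l l') :
    ReflTransGen (CyclicStep Y) l l' :=
  h.lift id fun _ _ h => .swap h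

theorem CyclicStep.reflTransGen_symm {l l' : List V} (h : ReflTransGen (CyclicStep Y) l l') :
    ReflTransGen (CyclicStep Y) l' l := by
  induction h with
  | refl => exact .refl
  | tail _ h ih => exact ih.head h.symm

/-- A letter adjacent in `Y` to all letters of a word but at most one may be put in front. -/
theorem CyclicStep.cons {v w : V} {l l' : List V} (h : CyclicStep Y l l') (hl : l.Nodup)
    (hv : ∀ u ∈ l, u ≠ w → Y.Adj v u) : ReflTransGen (CyclicStep Y) (v :: l) (v :: l') := by
  cases h with
  | swap h => exact .single (.swap (by simpa using h.append [v] []))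
  | rotate p q =>
    have key : ∀ p q : List V, (∀ u ∈ p, Y.Adj v u) →
        ReflTransGen (CyclicStep Y) (v :: (p ++ q)) (v :: (q ++ p)) := by
      intro p q hp
      have h₁ := CyclicStep.of_swaps (SwapStep.reflTransGen_append
        (SwapStep.cons_append hp) [] q)
      refine .tail h₁ ?_
      simpa using CyclicStep.rotate (Y := Y) p (v :: q)
    -- The word has no repetition, so `w` is missing from `p` or from `q`, and `v` can pass that
    -- part.
    by_cases hw : w ∈ p
    · refine CyclicStep.reflTransGen_symm (key q p fun u hu => ?_)
      refine hv u (by simp [hu]) ?_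
      rintro rfl
      exact (List.disjoint_of_nodup_append hl) hw hu
    · exact key p q fun u hu => hv u (by simp [hu]) fun e => hw (e ▸ hu)

theorem CyclicStep.reflTransGen_perm {l l' : List V} (h : ReflTransGen (CyclicStep Y) l l') :
    l.Perm l' := by
  induction h with
  | refl => exact .refl _
  | tail _ h ih => exact ih.trans h.perm

theorem CyclicStep.reflTransGen_cons {v w : V} {l l' : List V}
    (h : ReflTransGen (CyclicStep Y) l l') (hl : l.Nodup)
    (hv : ∀ u ∈ l, u ≠ w → Y.Adj v u) : ReflTransGen (CyclicStep Y) (v :: l) (v :: l') := by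
  induction h with
  | refl => exact .refl
  | tail h₁ h₂ ih =>
    have hp := CyclicStep.reflTransGen_perm h₁
    exact ih.trans (h₂.cons (hp.nodup_iff.1 hl) fun u hu => hv u (hp.mem_iff.2 hu))

/-- If the complement of `Y` is a forest, then any two arrangements of the same distinct letters
around a circle are related by exchanges of consecutive letters adjacent in `Y`. -/
theorem CyclicStep.reflTransGen_of_perm (hY : Yᶜ.IsAcyclic) {l l' : List V} (hl : l.Nodup)
    (h : l.Perm l') : ReflTransGen (CyclicStep Y) l l' := by
  induction hn : l.length generalizing l l' with
  | zero =>
    obtain rfl := List.length_eq_zero_iff.1 hn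
    rw [List.nil_perm.1 h]
  | succ n ih =>
    obtain ⟨v, hv, w, hw⟩ := hY.exists_mem_adj_imp_eq l (by rintro rfl; simp at hn)
    obtain ⟨a, b, rfl⟩ := List.append_of_mem hv
    obtain ⟨a', b', rfl⟩ := List.append_of_mem (h.mem_iff.1 hv)
    -- Both words are rotated to start with `v`; induction applies to what follows.
    have h₁ : CyclicStep Y (a ++ v :: b) (v :: (b ++ a)) := .rotate a (v :: b)
    have h₂ : CyclicStep Y (v :: (b' ++ a')) (a' ++ v :: b') := .rotate (v :: b') a'
    have hnd : (v :: (b ++ a)).Nodup := h₁.perm.nodup_iff.1 hl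
    have hp : (b ++ a).Perm (b' ++ a') :=
      List.Perm.cons_inv ((h₁.perm.symm.trans h).trans h₂.symm.perm)
    have hlen := h₁.perm.length_eq
    rw [hn, List.length_cons] at hlen
    rw [List.nodup_cons] at hnd
    refine .head h₁ (.tail (CyclicStep.reflTransGen_cons (w := w) (ih hnd.2 hp (by omega)) hnd.2
      fun u hu huw => ?_) h₂)
    by_contra huv
    refine huw (hw u (h₁.perm.mem_iff.2 (by simp [hu])) ?_)
    rw [SimpleGraph.compl_adj]
    exact ⟨fun e => hnd.1 (e ▸ hu), huv⟩

end Words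

/-! ### Flows with constant divergence on the complement. -/

section Flow

/-- A path from `x` to `y` carries a unit flow from `x` to `y`. -/
theorem SimpleGraph.Reachable.exists_flow {V : Type*} [Fintype V] [DecidableEq V] {A : Type*}
    [AddCommGroup A] {G : SimpleGraph V} {x y : V} (h : G.Reachable x y) (a : A) :
    ∃ c : V → V → A, (∀ u v, ¬ G.Adj u v → c u v = 0) ∧
      ∀ u, ∑ v, (c v u - c u v) = (if u = y then a else 0) - (if u = x then a else 0) := by
  obtain ⟨p⟩ := h
  induction p with
  | nil => exact ⟨0, by simp, by simp⟩
  | @cons x y z hxy p ih =>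
    obtain ⟨c, hc, hs⟩ := ih
    refine ⟨fun u v => c u v + if u = x ∧ v = y then a else 0, fun u v huv => ?_, fun u => ?_⟩
    · beta_reduce
      rw [hc u v huv, if_neg, zero_add]
      rintro ⟨rfl, rfl⟩
      exact huv hxy
    · have : ∀ v, (c v u + (if v = x ∧ u = y then a else 0)) -
          (c u v + (if u = x ∧ v = y then a else 0)) =
          (c v u - c u v) + ((if v = x then if u = y then a else 0 else 0) -
            (if v = y then if u = x then a else 0 else 0)) := by
        intro v
        have h₁ : (if u = x ∧ v = y then a else 0) =
            if v = y then if u = x then a else 0 else 0 := by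
          by_cases h : v = y <;> simp [h]
        rw [h₁, ite_and]
        abel
      simp only [this, Finset.sum_add_distrib, hs, Finset.sum_sub_distrib, Finset.sum_ite_eq',
        Finset.mem_univ, if_true]
      abel

/-- If the number of vertices of every connected component vanishes in `ZMod k`, there is a flow
along the edges with constant divergence one. -/
theorem SimpleGraph.exists_flow_eq_one {V : Type*} [Fintype V] (G : SimpleGraph V) (k : ℕ)
    (hk : ∀ C : G.ConnectedComponent, k ∣ C.supp.ncard) :
    ∃ c : V → V → ZMod k, (∀ u v, ¬ G.Adj u v → c u v = 0) ∧
      ∀ u, ∑ v, (c v u - c u v) = 1 := by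
  classical
  -- Each vertex `x` receives one unit from the chosen representative of its component.
  have hr : ∀ x : V, G.Reachable (G.connectedComponentMk x).out x := fun x =>
    ConnectedComponent.exact (Quot.out_eq (G.connectedComponentMk x))
  choose c hc hs using fun x => (hr x).exists_flow (1 : ZMod k)
  refine ⟨fun u v => ∑ x, c x u v, fun u v h => Finset.sum_eq_zero fun x _ => hc x u v h,
    fun u => ?_⟩
  have : ∑ v, (∑ x, c x v u - ∑ x, c x u v) = ∑ x, ∑ v, (c x v u - c x u v) := by
    rw [Finset.sum_comm]
    exact Finset.sum_congr rfl fun v _ => (Finset.sum_sub_distrib _ _).symm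
  rw [this]
  simp only [hs, Finset.sum_sub_distrib, Finset.sum_ite_eq, Finset.mem_univ, if_true]
  -- What `u` sends out is the number of vertices it represents: the size of its component or zero.
  rw [sub_eq_self, Finset.sum_boole, ZMod.natCast_eq_zero_iff]
  by_cases hu : u = (G.connectedComponentMk u).out
  · convert hk (G.connectedComponentMk u)
    rw [← Set.ncard_coe_finset]
    congr 1
    ext x
    simp only [Finset.coe_filter, Finset.mem_univ, true_and, Set.mem_ofPred_eq,
      ConnectedComponent.mem_supp_iff]
    constructor
    · intro h
      rw [h]
      exact (Quot.out_eq (G.connectedComponentMk x)).symm.trans (by rfl)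
    · intro h
      rw [h]
      exact hu
  · rw [Finset.filter_false_of_mem]
    · simp
    · intro x _ h
      apply hu
      have : G.connectedComponentMk u = G.connectedComponentMk x := by
        rw [h]; exact Quot.out_eq (G.connectedComponentMk x)
      rw [this]
      exact h

theorem componentSizeGcd_dvd {V : Type*} [Finite V] (G : SimpleGraph V)
    (C : G.ConnectedComponent) : componentSizeGcd G ∣ C.supp.ncard := by
  unfold componentSizeGcd
  let _ : Fintype G.ConnectedComponent := Fintype.ofFinite G.ConnectedComponent
  exact Finset.gcd_dvd (Finset.mem_univ C)

theorem dvd_componentSizeGcd {V : Type*} [Finite V] (G : SimpleGraph V) {d : ℕ}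
    (h : ∀ C : G.ConnectedComponent, d ∣ C.supp.ncard) : d ∣ componentSizeGcd G := by
  unfold componentSizeGcd
  exact Finset.dvd_gcd fun C _ => h C

end Flow

/-! ### Symmetries of the cycle acting on `FS`. -/

/-- Precomposition with an automorphism of `X` is an automorphism of `FS X Y`. -/
def FS.precomp {V W : Type*} {X : SimpleGraph V} (Y : SimpleGraph W) (e : X ≃g X) :
    FS X Y ≃g FS X Y where
  toFun σ := e.toEquiv.trans σ
  invFun σ := e.symm.toEquiv.trans σ
  left_inv σ := by ext; simp
  right_inv σ := by ext; simp
  map_rel_iff' := by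
    intro σ τ
    constructor
    · rintro ⟨a, b, hX, hY, h₁, h₂, h₃⟩
      refine ⟨e a, e b, e.map_adj_iff.2 hX, hY, h₁, h₂, fun c hca hcb => ?_⟩
      simpa using h₃ (e.symm c) (fun h => hca (by simp [← h])) (fun h => hcb (by simp [← h]))
    · rintro ⟨a, b, hX, hY, h₁, h₂, h₃⟩
      refine ⟨e.symm a, e.symm b, e.symm.map_adj_iff.2 hX, by simpa using hY, by simpa using h₁,
        by simpa using h₂, fun c hca hcb => ?_⟩
      exact h₃ (e c) (fun h => hca (by simp [← h])) (fun h => hcb (by simp [← h]))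

theorem FS.precomp_apply {V W : Type*} {X : SimpleGraph V} (Y : SimpleGraph W) (e : X ≃g X)
    (σ : V ≃ W) (i : V) : FS.precomp Y e σ i = σ (e i) := rfl

theorem FS.precomp_mul {V W : Type*} {X : SimpleGraph V} (Y : SimpleGraph W) (e f : X ≃g X)
    (σ : V ≃ W) : FS.precomp Y (e * f) σ = FS.precomp Y f (FS.precomp Y e σ) := rfl

theorem FS.precomp_one {V W : Type*} {X : SimpleGraph V} (Y : SimpleGraph W)
    (σ : V ≃ W) : FS.precomp Y (1 : X ≃g X) σ = σ := rfl

/-- The rotation of the cycle graph. -/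
def cycleRotation (m : ℕ) : cycleGraph (m + 2) ≃g cycleGraph (m + 2) where
  toEquiv := finRotate (m + 2)
  map_rel_iff' := by
    intro a b
    simp [cycleGraph_adj]

/-- The reflection of the cycle graph. -/
def cycleReflection (m : ℕ) : cycleGraph (m + 2) ≃g cycleGraph (m + 2) where
  toEquiv := Fin.revPerm
  map_rel_iff' := by
    intro a b
    have key : ∀ a b : Fin (m + 2), a.rev - b.rev = 1 ↔ b - a = 1 := by
      intro a b
      rw [sub_eq_iff_eq_add', sub_eq_iff_eq_add', ← Fin.rev_inj (i := b), Fin.rev_add,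
        eq_sub_iff_add_eq, eq_comm]
    simp only [cycleGraph_adj, Fin.revPerm_apply, key]
    exact or_comm

theorem cycleRotation_apply {m : ℕ} (i : Fin (m + 2)) : cycleRotation m i = i + 1 :=
  finRotate_apply i

theorem cycleReflection_apply {m : ℕ} (i : Fin (m + 2)) : cycleReflection m i = i.rev := rfl

theorem val_cycleRotation_pow {m : ℕ} (k : ℕ) (i : Fin (m + 2)) :
    ((cycleRotation m ^ k) i : ℕ) = (i + k) % (m + 2) := by
  induction k with
  | zero => simp [Nat.mod_eq_of_lt i.2]
  | succ k ih =>
    rw [pow_succ', RelIso.mul_apply, cycleRotation_apply, Fin.val_add, ih]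
    simp [add_assoc]

theorem cycleReflection_mul_self {m : ℕ} : cycleReflection m * cycleReflection m = 1 := by
  ext i
  simp [cycleReflection_apply]

theorem cycleReflection_mul_cycleRotation {m : ℕ} :
    cycleReflection m * cycleRotation m * cycleReflection m = (cycleRotation m)⁻¹ := by
  rw [eq_inv_iff_mul_eq_one]
  ext i
  simp only [RelIso.mul_apply, cycleRotation_apply, cycleReflection_apply, RelIso.one_apply]
  rw [Fin.rev_add, Fin.rev_rev, add_sub_cancel_right]

/-! ### From words back to arrangements on the cycle. -/

section Cycle

variable {V : Type*} {m : ℕ} {Y : SimpleGraph V}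

theorem FS.adj_of_eq_swap {σ τ : Fin (m + 2) ≃ V} {i : Fin (m + 2)}
    (h : Y.Adj (σ i) (σ (i + 1))) (hτ : τ = (Equiv.swap i (i + 1)).trans σ) :
    (FS (cycleGraph (m + 2)) Y).Adj σ τ := by
  subst hτ
  refine ⟨i, i + 1, cycleGraph_adj.2 (.inr (by simp)), h, by simp, by simp, fun c h₁ h₂ => ?_⟩
  simp [Equiv.swap_apply_of_ne_of_ne h₁ h₂]

theorem FS.exists_swap_of_adj {σ τ : Fin (m + 2) ≃ V}
    (h : (FS (cycleGraph (m + 2)) Y).Adj σ τ) :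
    ∃ i, Y.Adj (σ i) (σ (i + 1)) ∧ τ = (Equiv.swap i (i + 1)).trans σ := by
  obtain ⟨a, b, hX, hY, h₁, h₂, h₃⟩ := h
  have key : τ = (Equiv.swap a b).trans σ := by
    ext c
    rw [Equiv.trans_apply, Equiv.swap_apply_def]
    split_ifs with hca hcb
    · rw [hca, h₂]
    · rw [hcb, h₁]
    · exact (h₃ c hca hcb).symm
  rcases cycleGraph_adj.1 hX with h | h
  · obtain rfl : a = b + 1 := by rw [← h]; abel
    exact ⟨b, hY.symm, by rw [key, Equiv.swap_comm]⟩
  · obtain rfl : b = a + 1 := by rw [← h]; abel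
    exact ⟨a, hY, key⟩

theorem List.ofFn_precomp_rotation {σ : Fin (m + 2) ≃ V} {p q : List V}
    (h : List.ofFn σ = p ++ q) :
    List.ofFn (FS.precomp Y (cycleRotation m ^ p.length) σ) = q ++ p := by
  rw [← List.rotate_append_length_eq, ← h]
  refine List.ext_getElem (by simp) fun i h₁ h₂ => ?_
  rw [List.getElem_rotate]
  simp only [List.getElem_ofFn, FS.precomp_apply, List.length_ofFn]
  congr 1
  exact Fin.ext (val_cycleRotation_pow _ _)

theorem SwapStep.exists_adj {l : List V} {σ : Fin (m + 2) ≃ V} (h : SwapStep Y (List.ofFn σ) l) :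
    ∃ τ : Fin (m + 2) ≃ V, List.ofFn τ = l ∧ (FS (cycleGraph (m + 2)) Y).Adj σ τ := by
  generalize hl : List.ofFn σ = l₀ at h
  obtain ⟨p, q, hY⟩ := h
  rename_i a b
  have hlen : p.length + (q.length + 2) = m + 2 := by simpa using (congrArg List.length hl).symm
  set i : Fin (m + 2) := ⟨p.length, by omega⟩ with hi
  have hi₁ : ((i + 1 : Fin (m + 2)) : ℕ) = p.length + 1 := by
    rw [Fin.val_add_one_of_lt' (by simp [hi]; omega)]
  have hget : ∀ j : Fin (m + 2), σ j = (p ++ a :: b :: q)[(j : ℕ)]'(by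
      have := j.2; simp; omega) := by
    intro j
    simp only [← hl, List.getElem_ofFn]
  have ha : σ i = a := by rw [hget]; simp [hi]
  have hb : σ (i + 1) = b := by rw [hget]; simp [hi₁]
  refine ⟨(Equiv.swap i (i + 1)).trans σ, ?_, FS.adj_of_eq_swap (by rwa [ha, hb]) rfl⟩
  refine List.ext_getElem (by simp; omega) fun j h₁ h₂ => ?_
  have hj : j < m + 2 := by rwa [List.length_ofFn] at h₁
  simp only [List.getElem_ofFn, Equiv.trans_apply]
  rw [Equiv.swap_apply_def]
  split_ifs with e₁ e₂
  · obtain rfl : j = p.length := congrArg Fin.val e₁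
    simp [hb]
  · obtain rfl : j = p.length + 1 := by rw [← hi₁]; exact congrArg Fin.val e₂
    simp [ha]
  · have n₁ : j ≠ p.length := fun e => e₁ (Fin.ext e)
    have n₂ : j ≠ p.length + 1 := fun e => e₂ (Fin.ext (e.trans hi₁.symm))
    rw [hget]
    rcases lt_or_ge j p.length with hlt | hge
    · simp [List.getElem_append_left, hlt]
    · obtain ⟨k, rfl⟩ : ∃ k, j = p.length + (k + 2) := ⟨j - p.length - 2, by omega⟩
      simp

theorem SwapStep.exists_reachable {l : List V} {σ : Fin (m + 2) ≃ V}
    (h : ReflTransGen (SwapStep Y) (List.ofFn σ) l) :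
    ∃ τ : Fin (m + 2) ≃ V, List.ofFn τ = l ∧ (FS (cycleGraph (m + 2)) Y).Reachable σ τ := by
  induction h with
  | refl => exact ⟨σ, rfl, .refl _⟩
  | tail _ h ih =>
    obtain ⟨τ, rfl, hτ⟩ := ih
    obtain ⟨υ, rfl, hυ⟩ := h.exists_adj
    exact ⟨υ, rfl, hτ.trans hυ.reachable⟩

theorem FS.reachable_precomp (e : cycleGraph (m + 2) ≃g cycleGraph (m + 2))
    {σ τ : Fin (m + 2) ≃ V} (h : (FS (cycleGraph (m + 2)) Y).Reachable σ τ) :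
    (FS (cycleGraph (m + 2)) Y).Reachable (FS.precomp Y e σ) (FS.precomp Y e τ) :=
  h.map (FS.precomp Y e).toHom

/-- Swaps are edges of `FS`; rotations of the word are not, and are collected in the exponent `k`.
-/
theorem CyclicStep.exists_reachable {l : List V} {σ : Fin (m + 2) ≃ V}
    (h : ReflTransGen (CyclicStep Y) (List.ofFn σ) l) :
    ∃ τ : Fin (m + 2) ≃ V, List.ofFn τ = l ∧
      ∃ k : ℤ, (FS (cycleGraph (m + 2)) Y).Reachable σ (FS.precomp Y (cycleRotation m ^ k) τ) := by
  induction h with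
  | refl => exact ⟨σ, rfl, 0, by rw [zpow_zero, FS.precomp_one]⟩
  | tail _ h ih =>
    obtain ⟨τ, rfl, k, hτ⟩ := ih
    generalize hl : List.ofFn τ = l at h
    cases h with
    | swap h =>
      subst hl
      obtain ⟨υ, rfl, hυ⟩ := h.exists_adj
      exact ⟨υ, rfl, k, hτ.trans (FS.reachable_precomp _ hυ.reachable)⟩
    | rotate p q =>
      refine ⟨_, List.ofFn_precomp_rotation (Y := Y) hl, k - p.length, ?_⟩
      rw [← FS.precomp_mul, ← zpow_natCast, ← zpow_add, add_sub_cancel]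
      exact hτ

theorem List.ofFn_perm [Fintype V] (σ : Fin (m + 2) ≃ V) {l : List V} (hl : l.Nodup)
    (h : ∀ v, v ∈ l) : (List.ofFn σ).Perm l := by
  rw [List.perm_ext_iff_of_nodup (List.nodup_ofFn.2 σ.injective) hl]
  exact fun v => iff_of_true (List.mem_ofFn.2 ⟨σ.symm v, by simp⟩) (h v)

theorem FS.exists_reachable_ofFn_eq [Fintype V] (hY : Yᶜ.IsAcyclic) (σ : Fin (m + 2) ≃ V)
    {l : List V} (hl : l.Nodup) (h : ∀ v, v ∈ l) :
    ∃ τ : Fin (m + 2) ≃ V, List.ofFn τ = l ∧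
      ∃ k : ℤ, (FS (cycleGraph (m + 2)) Y).Reachable σ (FS.precomp Y (cycleRotation m ^ k) τ) :=
  CyclicStep.exists_reachable (CyclicStep.reflTransGen_of_perm hY
    (List.nodup_ofFn.2 σ.injective) (List.ofFn_perm σ hl h))

/-- If the complement of `Y` is a forest, any two vertices of `FS (cycleGraph n) Y` lie in the same
connected component up to a rotation of the cycle. -/
theorem FS.exists_reachable_rotation [Fintype V] (hY : Yᶜ.IsAcyclic) (σ τ : Fin (m + 2) ≃ V) :
    ∃ k : ℤ, (FS (cycleGraph (m + 2)) Y).Reachable σ (FS.precomp Y (cycleRotation m ^ k) τ) := by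
  obtain ⟨τ', h, k, hk⟩ := FS.exists_reachable_ofFn_eq hY σ (List.nodup_ofFn.2 τ.injective)
    fun v => List.mem_ofFn.2 ⟨τ.symm v, by simp⟩
  obtain rfl : τ' = τ := DFunLike.coe_injective (List.ofFn_injective h)
  exact ⟨k, hk⟩

/-- No edge of `Yᶜ` leaves `C`, so once its letters form an initial block, the block can pass the
remaining letters by swaps. The result is a rotation by the block length, and the rotation used to
reach the block form cancels. -/
theorem FS.reachable_rotation_ncard_supp [Fintype V] (hY : Yᶜ.IsAcyclic) (σ : Fin (m + 2) ≃ V)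
    (C : Yᶜ.ConnectedComponent) :
    (FS (cycleGraph (m + 2)) Y).Reachable σ
      (FS.precomp Y (cycleRotation m ^ (C.supp.ncard : ℤ)) σ) := by
  classical
  set s : Finset V := {v | v ∈ C.supp} with hs
  have hcard : s.toList.length = C.supp.ncard := by
    rw [Finset.length_toList, ← Set.ncard_coe_finset]
    congr 1
    ext v
    simp [hs]
  obtain ⟨τ, h, k, hk⟩ := FS.exists_reachable_ofFn_eq hY σ
    (l := s.toList ++ sᶜ.toList)
    (List.Nodup.append s.nodup_toList sᶜ.nodup_toList (by intro v; simp))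
    (by intro v; simp [em])
  have hswap : ReflTransGen (SwapStep Y) (List.ofFn τ) (sᶜ.toList ++ s.toList) := by
    rw [h]
    refine SwapStep.append_comm fun a ha b hb => ?_
    rw [Finset.mem_toList] at ha hb
    by_contra hab
    have : Yᶜ.Adj a b := by
      rw [compl_adj]
      exact ⟨fun e => Finset.mem_compl.1 hb (e ▸ ha), hab⟩
    refine Finset.mem_compl.1 hb ?_
    simp only [hs, Finset.mem_filter, Finset.mem_univ, true_and] at ha ⊢
    exact ConnectedComponent.mem_supp_of_adj_mem_supp C ha this
  obtain ⟨υ, hυ, hr⟩ := SwapStep.exists_reachable hswap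
  have hυ' := List.ofFn_precomp_rotation (Y := Y) h
  obtain rfl := DFunLike.coe_injective (List.ofFn_injective (hυ.trans hυ'.symm))
  refine hk.trans ((FS.reachable_precomp _ hr).trans ?_)
  rw [← FS.precomp_mul, hcard, ← zpow_natCast, ← zpow_add, add_comm (C.supp.ncard : ℤ), zpow_add,
    FS.precomp_mul]
  exact FS.reachable_precomp _ hk.symm

theorem FS.reachable_rotation_of_dvd [Fintype V] (hY : Yᶜ.IsAcyclic) (σ : Fin (m + 2) ≃ V)
    {k : ℤ} (hk : (componentSizeGcd Yᶜ : ℤ) ∣ k) :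
    (FS (cycleGraph (m + 2)) Y).Reachable σ (FS.precomp Y (cycleRotation m ^ k) σ) := by
  -- Quantifying over all `σ` makes these exponents a subgroup of `ℤ`; its generator divides every
  -- component size, hence their gcd.
  let H : AddSubgroup ℤ :=
    { carrier := {k | ∀ σ, (FS (cycleGraph (m + 2)) Y).Reachable σ
        (FS.precomp Y (cycleRotation m ^ k) σ)}
      zero_mem' := fun σ => by rw [zpow_zero, FS.precomp_one]
      add_mem' := fun {a b} ha hb σ => by
        rw [zpow_add, FS.precomp_mul]
        exact (ha σ).trans (hb _)
      neg_mem' := fun {a} ha σ => by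
        have := ha (FS.precomp Y (cycleRotation m ^ (-a)) σ)
        rw [← FS.precomp_mul, ← zpow_add, neg_add_cancel, zpow_zero, FS.precomp_one] at this
        exact this.symm }
  obtain ⟨d, hd⟩ := Int.subgroup_cyclic H
  have hmem : ∀ a : ℤ, a ∈ H ↔ d ∣ a := by
    intro a
    rw [hd, ← AddSubgroup.zmultiples_eq_closure, Int.mem_zmultiples_iff]
  have hdvd : d.natAbs ∣ componentSizeGcd Yᶜ := dvd_componentSizeGcd _ fun C =>
    Int.natAbs_dvd_natAbs.2 ((hmem C.supp.ncard).1 fun σ =>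
      FS.reachable_rotation_ncard_supp hY σ C)
  exact (hmem k).2 ((Int.natAbs_dvd.1 (Int.natCast_dvd_natCast.2 hdvd)).trans hk) σ

/-- The total weight of the pairs of letters which occur in order in the arrangement `σ`. -/
def orderedWeight [Fintype V] {A : Type*} [AddCommMonoid A] (c : V → V → A)
    (σ : Fin (m + 2) ≃ V) : A :=
  ∑ u, ∑ v, if σ.symm u < σ.symm v then c u v else 0

/-! ### The invariant weight modulo `k`. -/

section Weight

variable [Fintype V] {k : ℕ} {c : V → V → ZMod k}

/-- Only the letter `σ 0` changes its relative order, moving from first to last: its inflow is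
gained and its outflow lost, a net change of one. -/
theorem orderedWeight_rotation (hc : ∀ u, ∑ v, (c v u - c u v) = 1) (σ : Fin (m + 2) ≃ V) :
    orderedWeight c (FS.precomp Y (cycleRotation m) σ) = orderedWeight c σ + 1 := by
  classical
  have key : ∀ u v, (if (FS.precomp Y (cycleRotation m) σ).symm u <
      (FS.precomp Y (cycleRotation m) σ).symm v then c u v else 0) =
      (if σ.symm u < σ.symm v then c u v else 0) +
        ((if v = σ 0 then c u v else 0) - (if u = σ 0 then c u v else 0)) := by
    intro u v
    obtain ⟨i, rfl⟩ := (FS.precomp Y (cycleRotation m) σ).surjective u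
    obtain ⟨j, rfl⟩ := (FS.precomp Y (cycleRotation m) σ).surjective v
    rw [Equiv.symm_apply_apply, Equiv.symm_apply_apply]
    simp only [FS.precomp_apply, cycleRotation_apply, Equiv.symm_apply_apply,
      EmbeddingLike.apply_eq_iff_eq, Fin.lt_def, Fin.ext_iff, Fin.val_add_one, Fin.val_zero]
    have := i.2
    have := j.2
    have hl : (Fin.last (m + 1) : ℕ) = m + 1 := rfl
    simp only [hl]
    generalize c _ _ = x
    split_ifs <;> first | contradiction | omega | simp
  simp only [orderedWeight, key, Finset.sum_add_distrib, Finset.sum_sub_distrib]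
  congr 1
  rw [← hc (σ 0), Finset.sum_sub_distrib]
  congr 1
  · simp
  · rw [Finset.sum_comm]
    simp

theorem orderedWeight_rotation_zpow (hc : ∀ u, ∑ v, (c v u - c u v) = 1) (a : ℤ)
    (σ : Fin (m + 2) ≃ V) :
    orderedWeight c (FS.precomp Y (cycleRotation m ^ a) σ) = orderedWeight c σ + a := by
  induction a using Int.induction_on with
  | zero => simp [FS.precomp_one]
  | succ a ih =>
    rw [zpow_add_one, FS.precomp_mul, orderedWeight_rotation hc, ih]
    push_cast
    ring
  | pred a ih =>
    have := orderedWeight_rotation (Y := Y) hc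
      (FS.precomp Y (cycleRotation m ^ (-(a : ℤ) - 1)) σ)
    rw [← FS.precomp_mul, ← zpow_add_one, sub_add_cancel, ih] at this
    push_cast at this ⊢
    linear_combination -this

/-- Two distinct letters are in order in exactly one of an arrangement and its reversal; the
diagonal of `c` vanishes. -/
theorem orderedWeight_reflection (hc : ∀ u v, ¬ Yᶜ.Adj u v → c u v = 0) (σ : Fin (m + 2) ≃ V) :
    orderedWeight c (FS.precomp Y (cycleReflection m) σ) =
      (∑ u, ∑ v, c u v) - orderedWeight c σ := by
  rw [eq_sub_iff_add_eq]
  simp only [orderedWeight, ← Finset.sum_add_distrib]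
  refine Finset.sum_congr rfl fun u _ => Finset.sum_congr rfl fun v _ => ?_
  obtain ⟨i, rfl⟩ := (FS.precomp Y (cycleReflection m) σ).surjective u
  obtain ⟨j, rfl⟩ := (FS.precomp Y (cycleReflection m) σ).surjective v
  rw [Equiv.symm_apply_apply, Equiv.symm_apply_apply]
  simp only [FS.precomp_apply, cycleReflection_apply, Equiv.symm_apply_apply, Fin.rev_lt_rev]
  rcases lt_trichotomy i j with h | rfl | h
  · simp [h, h.not_gt]
  · simp [hc]
  · simp [h, h.not_gt]

/-- Away from the seam, only the relative order of the two swapped letters changes, and they carry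
no weight because they are not adjacent in `Yᶜ`. -/
theorem orderedWeight_swap (hc : ∀ u v, ¬ Yᶜ.Adj u v → c u v = 0) (σ : Fin (m + 2) ≃ V)
    {i : Fin (m + 2)} (hi : i ≠ Fin.last (m + 1)) (h : Y.Adj (σ i) (σ (i + 1))) :
    orderedWeight c ((Equiv.swap i (i + 1)).trans σ) = orderedWeight c σ := by
  refine Finset.sum_congr rfl fun u _ => Finset.sum_congr rfl fun v _ => ?_
  by_cases huv : Yᶜ.Adj u v
  · obtain ⟨a, rfl⟩ := σ.surjective u
    obtain ⟨b, rfl⟩ := σ.surjective v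
    have hne : a ≠ b := by rintro rfl; exact huv.ne rfl
    have h₁ : ¬ (a = i ∧ b = i + 1) := by
      rintro ⟨rfl, rfl⟩
      exact ((compl_adj _ _ _).1 huv).2 h
    have h₂ : ¬ (b = i ∧ a = i + 1) := by
      rintro ⟨rfl, rfl⟩
      exact ((compl_adj _ _ _).1 huv).2 h.symm
    have hi' : ((i + 1 : Fin (m + 2)) : ℕ) = i + 1 := by rw [Fin.val_add_one, if_neg hi]
    refine if_congr ?_ rfl rfl
    simp only [Equiv.symm_trans_apply, Equiv.symm_swap, Equiv.symm_apply_apply]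
    rw [Equiv.swap_apply_def, Equiv.swap_apply_def]
    simp only [Fin.ext_iff, ne_eq, Fin.lt_def, apply_ite Fin.val, hi'] at *
    split_ifs <;> omega
  · simp [hc u v huv]

theorem orderedWeight_eq_of_adj (hc : ∀ u v, ¬ Yᶜ.Adj u v → c u v = 0)
    (hc' : ∀ u, ∑ v, (c v u - c u v) = 1) {σ τ : Fin (m + 2) ≃ V}
    (h : (FS (cycleGraph (m + 2)) Y).Adj σ τ) : orderedWeight c σ = orderedWeight c τ := by
  obtain ⟨i, hY, rfl⟩ := FS.exists_swap_of_adj h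
  by_cases hi : i = Fin.last (m + 1)
  -- A swap across the seam becomes an interior swap after one rotation, which shifts both weights
  -- by one.
  · obtain ⟨j, rfl⟩ := (cycleRotation m).surjective i
    have hj : j ≠ Fin.last (m + 1) := by
      rintro rfl
      rw [cycleRotation_apply, Fin.last_add_one] at hi
      exact (Fin.last_pos).ne hi
    have key : FS.precomp Y (cycleRotation m)
        ((Equiv.swap (cycleRotation m j) (cycleRotation m j + 1)).trans σ) =
        (Equiv.swap j (j + 1)).trans (FS.precomp Y (cycleRotation m) σ) := by
      ext a
      rw [FS.precomp_apply, Equiv.trans_apply, Equiv.trans_apply, FS.precomp_apply,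
        ← cycleRotation_apply (cycleRotation m j), ← cycleRotation_apply j]
      exact congrArg σ ((cycleRotation m).injective.swap_apply j (cycleRotation m j) a)
    have := orderedWeight_swap hc (FS.precomp Y (cycleRotation m) σ) hj
      (by simpa only [FS.precomp_apply, cycleRotation_apply] using hY)
    rw [← key, orderedWeight_rotation hc', orderedWeight_rotation hc'] at this
    exact (add_right_cancel this).symm
  · exact (orderedWeight_swap hc σ hi hY).symm

theorem orderedWeight_eq_of_reachable (hc : ∀ u v, ¬ Yᶜ.Adj u v → c u v = 0)
    (hc' : ∀ u, ∑ v, (c v u - c u v) = 1) {σ τ : Fin (m + 2) ≃ V}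
    (h : (FS (cycleGraph (m + 2)) Y).Reachable σ τ) : orderedWeight c σ = orderedWeight c τ := by
  obtain ⟨p⟩ := h
  induction p with
  | nil => rfl
  | cons h _ ih => exact (orderedWeight_eq_of_adj hc hc' h).trans ih

end Weight

/-- The connected components of `FS (cycleGraph n) Y` are the fibres of `orderedWeight`. -/
theorem FS.reachable_iff_orderedWeight_eq [Fintype V] (hY : Yᶜ.IsAcyclic)
    {c : V → V → ZMod (componentSizeGcd Yᶜ)} (hc : ∀ u v, ¬ Yᶜ.Adj u v → c u v = 0)
    (hc' : ∀ u, ∑ v, (c v u - c u v) = 1) {σ τ : Fin (m + 2) ≃ V} :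
    (FS (cycleGraph (m + 2)) Y).Reachable σ τ ↔ orderedWeight c σ = orderedWeight c τ := by
  refine ⟨orderedWeight_eq_of_reachable hc hc', fun h => ?_⟩
  obtain ⟨k, hk⟩ := FS.exists_reachable_rotation hY σ τ
  have := orderedWeight_eq_of_reachable hc hc' hk
  rw [orderedWeight_rotation_zpow hc', h, left_eq_add, ZMod.intCast_zmod_eq_zero_iff_dvd] at this
  exact hk.trans (FS.reachable_rotation_of_dvd hY τ this).symm

end Cycle

/-! ### Isomorphisms between components and the final count. -/

/-- A graph automorphism mapping a component `C` into a component `D` induces an isomorphism. -/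
def SimpleGraph.Iso.connectedComponent {W : Type*} {G : SimpleGraph W} (e : G ≃g G)
    {C D : G.ConnectedComponent} (h : C.map e.toHom = D) : C.toSimpleGraph ≃g D.toSimpleGraph where
  toEquiv := e.toEquiv.subtypeEquiv fun v => by
    subst h
    change G.connectedComponentMk v = C ↔
      G.connectedComponentMk (e.toHom v) = C.map e.toHom
    rw [← ConnectedComponent.map_mk]
    exact (e.connectedComponentEquiv.injective.eq_iff (a := G.connectedComponentMk v)).symm
  map_rel_iff' := e.map_adj_iff

theorem SimpleGraph.Iso.coe_connectedComponent_apply {W : Type*} {G : SimpleGraph W} (e : G ≃g G)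
    {C D : G.ConnectedComponent} (h : C.map e.toHom = D) (v : C) :
    (e.connectedComponent h v : W) = e v := rfl

theorem corollary4p9 {V : Type*} [Fintype V] (n : ℕ) (hn : 3 ≤ n) (hV : Fintype.card V = n)
    (Y : SimpleGraph V) (hY : Yᶜ.IsAcyclic) (ν : ℕ) (hν : ν = componentSizeGcd Yᶜ) :
    Nat.card (FS (SimpleGraph.cycleGraph n) Y).ConnectedComponent = ν ∧
    (∀ C D : (FS (SimpleGraph.cycleGraph n) Y).ConnectedComponent,
      Nonempty (C.toSimpleGraph ≃g D.toSimpleGraph)) ∧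
    (∀ C : (FS (SimpleGraph.cycleGraph n) Y).ConnectedComponent,
      (C.supp.ncard : ℚ) = (n ! : ℚ) / (ν : ℚ)) ∧
    (∀ C : (FS (SimpleGraph.cycleGraph n) Y).ConnectedComponent,
      ∃ f : C.toSimpleGraph ≃g C.toSimpleGraph, orderOf f = 2) := by
  classical
  obtain ⟨m, rfl⟩ : ∃ m, n = m + 1 + 2 := ⟨n - 3, by omega⟩
  subst hν
  set X := FS (cycleGraph (m + 1 + 2)) Y with hX
  obtain ⟨c, hc, hc'⟩ := Yᶜ.exists_flow_eq_one (componentSizeGcd Yᶜ) (componentSizeGcd_dvd _)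
  have hreach : ∀ {σ τ}, X.Reachable σ τ ↔ orderedWeight c σ = orderedWeight c τ :=
    FS.reachable_iff_orderedWeight_eq hY hc hc'
  obtain ⟨σ₀⟩ : Nonempty (Fin (m + 1 + 2) ≃ V) := ⟨(Fintype.equivFinOfCardEq hV).symm⟩
  have hcard : Nat.card X.ConnectedComponent = componentSizeGcd Yᶜ := by
    rw [← Nat.card_zmod (componentSizeGcd Yᶜ)]
    refine Nat.card_congr (Equiv.ofBijective (ConnectedComponent.lift (orderedWeight c)
      fun _ _ p _ => hreach.1 p.reachable) ⟨?_, fun x => ?_⟩)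
    · rintro ⟨σ⟩ ⟨τ⟩ h
      exact ConnectedComponent.sound (hreach.2 h)
    · obtain ⟨a, ha⟩ := ZMod.intCast_surjective (x - orderedWeight c σ₀)
      refine ⟨X.connectedComponentMk (FS.precomp Y (cycleRotation (m + 1) ^ a) σ₀), ?_⟩
      rw [ConnectedComponent.lift_mk, orderedWeight_rotation_zpow hc', ha, add_sub_cancel]
  have hiso : ∀ C D : X.ConnectedComponent, Nonempty (C.toSimpleGraph ≃g D.toSimpleGraph) := by
    rintro ⟨σ⟩ ⟨τ⟩
    obtain ⟨a, ha⟩ := ZMod.intCast_surjective (orderedWeight c τ - orderedWeight c σ)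
    refine ⟨(FS.precomp Y (cycleRotation (m + 1) ^ a)).connectedComponent
      (ConnectedComponent.sound (hreach.2 ?_))⟩
    refine (orderedWeight_rotation_zpow hc' a σ).trans ?_
    rw [ha, add_sub_cancel]
  refine ⟨hcard, hiso, fun C => ?_, ?_⟩
  · have hfin : Fintype X.ConnectedComponent := Fintype.ofFinite _
    have hsum : (m + 1 + 2)! = ∑ D : X.ConnectedComponent, D.supp.ncard := by
      have h₁ : Nat.card (Fin (m + 1 + 2) ≃ V) = (m + 1 + 2)! := by
        rw [Nat.card_eq_fintype_card, Fintype.card_equiv σ₀, Fintype.card_fin]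
      rw [← h₁, Nat.card_congr (Equiv.sigmaFiberEquiv X.connectedComponentMk).symm, Nat.card_sigma]
      rfl
    have hconst : ∀ D : X.ConnectedComponent, D.supp.ncard = C.supp.ncard := fun D =>
      Nat.card_congr (hiso D C).some.toEquiv
    simp only [hconst, Finset.sum_const, Finset.card_univ, smul_eq_mul] at hsum
    rw [← Nat.card_eq_fintype_card, hcard] at hsum
    -- A zero gcd would make the factorial zero.
    have hν : (componentSizeGcd Yᶜ : ℚ) ≠ 0 := by
      intro h0
      rw [Nat.cast_eq_zero] at h0
      rw [h0, zero_mul] at hsum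
      exact Nat.factorial_ne_zero _ hsum
    rw [hsum]
    push_cast
    field_simp
  · refine ConnectedComponent.ind fun σ => ?_
    -- Rotation by `a` undoes the change of weight caused by the reflection.
    obtain ⟨a, ha⟩ := ZMod.intCast_surjective
      (orderedWeight c σ - (∑ u, ∑ v, c u v - orderedWeight c σ))
    set e := cycleReflection (m + 1) * cycleRotation (m + 1) ^ a with he
    have hmap : (X.connectedComponentMk σ).map (FS.precomp Y e).toHom =
        X.connectedComponentMk σ := by
      refine ConnectedComponent.sound (hreach.2 ?_)
      change orderedWeight c (FS.precomp Y e σ) = _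
      rw [he, FS.precomp_mul, orderedWeight_rotation_zpow hc', orderedWeight_reflection hc, ha]
      ring
    have hee : e * e = 1 := by
      have : cycleReflection (m + 1) * cycleRotation (m + 1) ^ a * cycleReflection (m + 1) =
          cycleRotation (m + 1) ^ (-a) := by
        have hinv : cycleReflection (m + 1) = (cycleReflection (m + 1))⁻¹ :=
          eq_inv_of_mul_eq_one_left cycleReflection_mul_self
        have h := conj_zpow (i := a) (a := cycleReflection (m + 1)) (b := cycleRotation (m + 1))
        rw [← hinv, cycleReflection_mul_cycleRotation] at h
        rw [← h, inv_zpow, zpow_neg]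
      rw [he, ← mul_assoc, this, ← zpow_add, neg_add_cancel, zpow_zero]
    -- Otherwise the reflection would be a power of the rotation and commute with it, forcing the
    -- rotation to square to one; this fails for at least three vertices.
    have he1 : e ≠ 1 := by
      intro h1
      have hr : cycleReflection (m + 1) = (cycleRotation (m + 1) ^ a)⁻¹ :=
        eq_inv_of_mul_eq_one_left h1
      have hcomm : cycleReflection (m + 1) * cycleRotation (m + 1) =
          cycleRotation (m + 1) * cycleReflection (m + 1) := by
        rw [hr]
        exact ((Commute.refl _).zpow_left a).inv_left.eq
      have h := cycleReflection_mul_cycleRotation (m := m + 1)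
      rw [hcomm, mul_assoc, cycleReflection_mul_self, mul_one, eq_inv_iff_mul_eq_one] at h
      have h0 := congrArg Fin.val (DFunLike.congr_fun h 0)
      simp only [RelIso.mul_apply, cycleRotation_apply, RelIso.one_apply, zero_add] at h0
      rw [Fin.val_add_one, Fin.val_one, if_neg (by simp [Fin.ext_iff])] at h0
      simp at h0
    refine ⟨(FS.precomp Y e).connectedComponent hmap, orderOf_eq_prime ?_ ?_⟩
    · ext τ : 1
      refine Subtype.ext ?_
      rw [pow_two, RelIso.mul_apply, Iso.coe_connectedComponent_apply,
        Iso.coe_connectedComponent_apply, ← FS.precomp_mul, hee]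
      rfl
    -- Fixing the single arrangement `σ` already forces `e = 1`, since `σ` is injective.
    · intro h
      apply he1
      ext i
      have h2 : FS.precomp Y e σ = σ := congrArg Subtype.val
        (DFunLike.congr_fun h (⟨σ, rfl⟩ : (X.connectedComponentMk σ).supp))
      exact congrArg Fin.val (σ.injective (DFunLike.congr_fun h2 i))
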